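/- For $0<\alpha\le 2$, $0<\rho<1$ and $0<\beta<1$ put $$g(\beta)=\frac{\sin(\pi\rho)}{\pi}\int_0^\infty\frac{\beta\log(1+x^\alpha)}{x^2+2x\beta\cos(\pi\rho)+\beta^2}\,dx ,$$ and for an integer $k\ge 0$, $a\in\mathbb R$ and $|x|<1$ put $$g_k(a,x)=\sum_{m=1}^\infty\frac{x^m\,U_{k-1}(\cos(m\pi a))}{m},$$ where $U_n$ are the Chebyshev polynomials of the second kind, with $U_{-1}\equiv 0$. (i) Suppose that $\rho+k=l/\alpha$ for some integers $k,l\ge 0$. Then the integral defining $g(\beta)$ converges absolutely and $$g(\beta)=g_k\bigl(\alpha,(-1)^{l+1}\beta^\alpha\bigr)-g_l\bigl(1/\alpha,(-1)^{k+1}\beta\bigr).$$ (ii) For every integer $k\ge0$, every real $a$ and every real $x$ with $|x|<1$, the series $g_k(a,x)$ converges absolutely and equals $-L_k(a,x)$, where $$L_k(a,x)=\begin{cases}\displaystyle\sum_{n=0}^{k/2-1}\log\bigl(x^2-2x\cos((2n+1)a\pi)+1\bigr), & k \text{ even},\\[2ex] \displaystyle\log(1-x)+\sum_{n=1}^{(k-1)/2}\log\bigl(x^2-2x\cos(2na\pi)+1\bigr),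 & k\text{ odd}.\end{cases}$$ Consequently, in the situation of (i), $g(\beta)=L_l\bigl(1/\alpha,(-1)^{k+1}\beta\bigr)-L_k\bigl(\alpha,(-1)^{l+1}\beta^\alpha\bigr)$. -/

import Mathlib

/-- The integrand of `stableG`, without the prefactor `sin (π ρ) / π`. -/
noncomputable def stableGIntegrand (α ρ β x : ℝ) : ℝ :=
  β * Real.log (1 + x ^ α) / (x ^ 2 + 2 * x * β * Real.cos (Real.pi * ρ) + β ^ 2)

/-- `g(β)`, the logarithm (up to normalisation) of the bivariate Laplace exponent of the ascending
ladder process of the stable process with index `α` and positivity parameter `ρ`. -/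
noncomputable def stableG (α ρ β : ℝ) : ℝ :=
  Real.sin (Real.pi * ρ) / Real.pi * ∫ x in Set.Ioi (0 : ℝ), stableGIntegrand α ρ β x

/-- The term of index `m` of the series `g_k(a, x)`: `x ^ m * U_{k-1}(cos (m π a)) / m`, where `U`
is the Chebyshev polynomial of the second kind, indexed by integers, so that `U_{-1} = 0`. -/
noncomputable def chebyshevTerm (k : ℕ) (a x : ℝ) (m : ℕ) : ℝ :=
  x ^ m * (Polynomial.Chebyshev.U ℝ ((k : ℤ) - 1)).eval (Real.cos ((m : ℝ) * Real.pi * a)) / (m : ℝ)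

/-- `g_k(a, x) = ∑_{m ≥ 1} x ^ m * U_{k-1}(cos (m π a)) / m`. -/
noncomputable def chebyshevSeries (k : ℕ) (a x : ℝ) : ℝ :=
  ∑' m : ℕ, chebyshevTerm k a x (m + 1)

/-- The finite sum of logarithms that equals `-g_k(a, x)`. -/
noncomputable def logQuadraticSum (k : ℕ) (a x : ℝ) : ℝ :=
  if Even k then
    ∑ n ∈ Finset.range (k / 2),
      Real.log (x ^ 2 - 2 * x * Real.cos ((2 * (n : ℝ) + 1) * a * Real.pi) + 1)
  else
    Real.log (1 - x) + ∑ n ∈ Finset.Icc 1 ((k - 1) / 2),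
      Real.log (x ^ 2 - 2 * x * Real.cos (2 * (n : ℝ) * a * Real.pi) + 1)

/-! Both halves reduce to the symmetric logarithmic sum `symmLogSum`.

For the series, U_{k-1}(cos t) is the sum of cos((k-1-2j)t) over j < k, and each cosine contributes
the real part of the Taylor series of -log(1 - x e^{iψ}).

For the integral, put β = e^{-L} and x = e^{t-L}. Up to a constant, g becomes the integral over ℝ of
log(1 + e^{α(t-L)}) / (cosh t + cos πρ). Its L-derivative replaces the logarithm by -α times a
logistic function, and that integral is computed by residues: 1/((1 + (-1)^l e^{-α(z-L)})(1 + (-1)^k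
e^z)) is integrated around a rectangle of half-height π(ρ+k) = πl/α. This double expression for the
height is where the arithmetic hypothesis enters: on both horizontal sides the first factor equals 1
+ e^{-α(x-L)} and the second becomes 1 + e^{x ± iπρ}, whose reciprocals differ by a multiple of
1/(cosh x + cos πρ). The vertical sides vanish in the limit (`sin_mul_integral_logistic`).

The real parts of the residues are the logarithmic derivatives of the quadratics in `symmLogSum`
(`re_inv_signedOneAddExp`, `hasDerivAt_symmLogSum_exp`). So the two sides have equal L-derivatives,
and both tend to 0 as L → ∞; hence they agree. -/

/-- `½ ∑_{j<k} log (x² - 2x cos ((k-1-2j)aπ) + 1)`, the symmetric form of `logQuadraticSum`. -/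
noncomputable def symmLogSum (k : ℕ) (a x : ℝ) : ℝ :=
  (∑ j ∈ Finset.range k,
    Real.log (x ^ 2 - 2 * x * Real.cos (((k : ℝ) - 1 - 2 * j) * a * Real.pi) + 1)) / 2

/-! ### Chebyshev series as finite sums of logarithms. -/

theorem sum_range_symm_add_two (F : ℝ → ℝ) (k : ℕ) :
    ∑ j ∈ Finset.range (k + 2), F (((k + 2 : ℕ) : ℝ) - 1 - 2 * j) =
      F (k + 1) + F (-(k + 1)) + ∑ j ∈ Finset.range k, F ((k : ℝ) - 1 - 2 * j) := by
  rw [Finset.sum_range_succ, Finset.sum_range_succ']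
  have h : ∀ j : ℕ, ((k + 2 : ℕ) : ℝ) - 1 - 2 * ((j + 1 : ℕ) : ℝ) = (k : ℝ) - 1 - 2 * j := by
    intro j; push_cast; ring
  simp only [h]
  have h0 : ((k + 2 : ℕ) : ℝ) - 1 - 2 * ((0 : ℕ) : ℝ) = k + 1 := by push_cast; ring
  have h1 : (k : ℝ) - 1 - 2 * (k : ℝ) = -(k + 1) := by ring
  rw [h0, h1]; ring

theorem logQuadraticSum_add_two (k : ℕ) (a x : ℝ) :
    logQuadraticSum (k + 2) a x =
      Real.log (x ^ 2 - 2 * x * Real.cos (((k : ℝ) + 1) * a * Real.pi) + 1) +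
        logQuadraticSum k a x := by
  unfold logQuadraticSum
  rcases Nat.even_or_odd' k with ⟨m, rfl | rfl⟩
  · have h1 : Even (2 * m + 2) := by simp [parity_simps]
    have h2 : Even (2 * m) := by simp
    rw [if_pos h1, if_pos h2, show (2 * m + 2) / 2 = m + 1 by omega,
      show 2 * m / 2 = m by omega, Finset.sum_range_succ]
    push_cast; ring
  · have h1 : ¬ Even (2 * m + 1 + 2) := by simp [parity_simps]
    have h2 : ¬ Even (2 * m + 1) := by simp [parity_simps]
    rw [if_neg h1, if_neg h2, show (2 * m + 1 + 2 - 1) / 2 = m + 1 by omega,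
      show (2 * m + 1 - 1) / 2 = m by omega, Finset.sum_Icc_succ_top (by omega)]
    push_cast
    rw [show (2 * (m : ℝ) + 1 + 1) = 2 * (m + 1) by ring]; ring

theorem symmLogSum_add_two (k : ℕ) (a x : ℝ) :
    symmLogSum (k + 2) a x =
      Real.log (x ^ 2 - 2 * x * Real.cos (((k : ℝ) + 1) * a * Real.pi) + 1) +
        symmLogSum k a x := by
  unfold symmLogSum
  rw [sum_range_symm_add_two (fun s => Real.log (x ^ 2 - 2 * x * Real.cos (s * a * Real.pi) + 1)),
    show -((k : ℝ) + 1) * a * Real.pi = -((k + 1) * a * Real.pi) by ring, Real.cos_neg]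
  ring

/-- The indices j and k-1-j give the same cosine, so the factor ½ keeps one of each pair. For odd k
the middle term is ½ log((1-x)²) = log(1-x), valid for every real x because the real logarithm
ignores signs. -/
theorem logQuadraticSum_eq_symmLogSum (k : ℕ) (a x : ℝ) :
    logQuadraticSum k a x = symmLogSum k a x := by
  induction k using Nat.twoStepInduction with
  | zero => simp [logQuadraticSum, symmLogSum]
  | one =>
    simp only [logQuadraticSum, symmLogSum]
    simp only [Nat.not_even_one, if_false, Finset.range_one, Finset.sum_singleton]
    norm_num
    rw [show x ^ 2 - 2 * x + 1 = (1 - x) ^ 2 by ring, Real.log_pow]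
    push_cast; ring
  | more k h1 _ => rw [logQuadraticSum_add_two, symmLogSum_add_two, h1]

/-- This is sin(kt)/sin t written as a geometric sum. Induction through U_{n+2} = 2T_{n+2} + U_n
avoids dividing by sin t. -/
theorem chebyshev_U_eval_cos (k : ℕ) (t : ℝ) :
    (Polynomial.Chebyshev.U ℝ ((k : ℤ) - 1)).eval (Real.cos t) =
      ∑ j ∈ Finset.range k, Real.cos (((k : ℝ) - 1 - 2 * j) * t) := by
  induction k using Nat.twoStepInduction with
  | zero => simp
  | one => simp
  | more k h1 _ =>
    rw [sum_range_symm_add_two (fun s => Real.cos (s * t)), ← h1,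
      show (((k + 2 : ℕ) : ℤ) - 1) = ((k : ℤ) - 1) + 2 by push_cast; ring,
      Polynomial.Chebyshev.U_eq_two_mul_T_add_U]
    rw [show -((k : ℝ) + 1) * t = -((k + 1) * t) by ring, Real.cos_neg,
      show (k : ℤ) - 1 + 2 = (k : ℤ) + 1 by ring]
    simp only [Polynomial.eval_add, Polynomial.eval_mul, Polynomial.Chebyshev.T_real_cos]
    push_cast
    simp; ring

theorem normSq_sub_exp_mul_I (x ψ : ℝ) :
    Complex.normSq (x - Complex.exp (ψ * Complex.I)) = x ^ 2 - 2 * x * Real.cos ψ + 1 := by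
  rw [Complex.normSq_apply, Complex.sub_re, Complex.sub_im, Complex.exp_ofReal_mul_I_re,
    Complex.exp_ofReal_mul_I_im, Complex.ofReal_re, Complex.ofReal_im]
  nlinarith [Real.sin_sq_add_cos_sq ψ]

theorem sq_sub_two_mul_cos_add_one_pos {x : ℝ} (hx : |x| < 1) (ψ : ℝ) :
    0 < x ^ 2 - 2 * x * Real.cos ψ + 1 := by
  have h1 : |x * Real.cos ψ| ≤ |x| := by
    rw [abs_mul]; exact mul_le_of_le_one_right (abs_nonneg _) (Real.abs_cos_le_one _)
  nlinarith [le_abs_self (x * Real.cos ψ), sq_abs x]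

theorem hasSum_pow_mul_cos_div {x : ℝ} (hx : |x| < 1) (ψ : ℝ) :
    HasSum (fun m : ℕ => x ^ (m + 1) * Real.cos (((m + 1 : ℕ) : ℝ) * ψ) / ((m + 1 : ℕ) : ℝ))
      (-(Real.log (x ^ 2 - 2 * x * Real.cos ψ + 1) / 2)) := by
  have hz : ‖(x : ℂ) * Complex.exp (ψ * Complex.I)‖ < 1 := by
    simpa [Complex.norm_exp_ofReal_mul_I] using hx
  -- The dropped term of index 0 is z^0/0, which is 0 by convention, so the sum is unchanged.
  have h := Complex.hasSum_re ((hasSum_nat_add_iff' 1).mpr (Complex.hasSum_taylorSeries_neg_log hz))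
  have hnorm : ‖1 - (x : ℂ) * Complex.exp (ψ * Complex.I)‖ ^ 2 =
      x ^ 2 - 2 * x * Real.cos ψ + 1 := by
    rw [← Complex.normSq_eq_norm_sq, Complex.normSq_apply]
    simp only [Complex.sub_re, Complex.sub_im, Complex.re_ofReal_mul, Complex.im_ofReal_mul,
      Complex.exp_ofReal_mul_I_re, Complex.exp_ofReal_mul_I_im, Complex.one_re, Complex.one_im]
    linear_combination x ^ 2 * Real.sin_sq_add_cos_sq ψ
  convert h using 1
  · funext m
    rw [mul_pow, ← Complex.exp_nat_mul,
      show (((m + 1 : ℕ) : ℂ) * (ψ * Complex.I)) = (((((m + 1 : ℕ) : ℝ) * ψ : ℝ) : ℂ) * Complex.I) by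
        push_cast; ring, ← Complex.ofReal_natCast, Complex.div_ofReal_re, ← Complex.ofReal_pow,
      Complex.re_ofReal_mul, Complex.exp_ofReal_mul_I_re]
  · rw [← hnorm, Real.log_pow]
    simp [Complex.log_re]

theorem hasSum_chebyshevTerm (k : ℕ) (a : ℝ) {x : ℝ} (hx : |x| < 1) :
    HasSum (fun m : ℕ => chebyshevTerm k a x (m + 1)) (-symmLogSum k a x) := by
  have h := hasSum_sum (s := Finset.range k)
    (fun j _ => hasSum_pow_mul_cos_div hx (((k : ℝ) - 1 - 2 * j) * a * Real.pi))
  convert h using 1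
  · funext m
    rw [chebyshevTerm, chebyshev_U_eval_cos, Finset.mul_sum, Finset.sum_div]
    refine Finset.sum_congr rfl fun j _ => ?_
    congr 3; ring
  · rw [symmLogSum, Finset.sum_neg_distrib, Finset.sum_div]

/-! ### The residue theorem on rectangles for simple poles. -/

section Residues

open Complex Set Filter Topology

/-- The counterclockwise integral of `f` over the boundary of `[x₀, x₁] × [y₀, y₁]`. -/
noncomputable def rectIntegral (f : ℂ → ℂ) (x₀ x₁ y₀ y₁ : ℝ) : ℂ :=
  (∫ x : ℝ in x₀..x₁, f (x + y₀ * I)) - (∫ x : ℝ in x₀..x₁, f (x + y₁ * I)) +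
    I * (∫ y : ℝ in y₀..y₁, f (x₁ + y * I)) - I * (∫ y : ℝ in y₀..y₁, f (x₀ + y * I))

theorem rectIntegral_eq_zero {f : ℂ → ℂ} {x₀ x₁ y₀ y₁ : ℝ} (hx : x₀ ≤ x₁) (hy : y₀ ≤ y₁)
    (hf : DifferentiableOn ℂ f (Icc x₀ x₁ ×ℂ Icc y₀ y₁)) : rectIntegral f x₀ x₁ y₀ y₁ = 0 := by
  have h := integral_boundary_rect_eq_zero_of_differentiableOn f (x₀ + y₀ * I) (x₁ + y₁ * I)
    (by simpa [uIcc_of_le hx, uIcc_of_le hy] using hf)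
  simpa [rectIntegral] using h

theorem hasDerivAt_log_horizontal (p : ℂ) (y x : ℝ) (h : y - p.im ≠ 0) :
    HasDerivAt (fun x : ℝ => log (x + y * I - p)) ((x + y * I - p)⁻¹) x := by
  have h1 : HasDerivAt (fun x : ℝ => (x : ℂ) + y * I - p) 1 x :=
    (((hasDerivAt_id x).ofReal_comp).add_const _).sub_const _
  have := h1.clog_real (Or.inr (by simpa using h))
  simpa using this

theorem hasDerivAt_log_right (p : ℂ) (y x : ℝ) (h : 0 < x - p.re) :
    HasDerivAt (fun y : ℝ => log (x + y * I - p)) (I * (x + y * I - p)⁻¹) y := by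
  have h1 : HasDerivAt (fun y : ℝ => (x : ℂ) + y * I - p) I y := by
    simpa using ((((hasDerivAt_id y).ofReal_comp).mul_const I).const_add (x : ℂ)).sub_const p
  have := h1.clog_real (Or.inl (by simpa using h))
  simpa [div_eq_mul_inv] using this

/-- To the left of p the principal logarithm of z - p meets its cut; negating the argument gives a
primitive that is smooth there. -/
theorem hasDerivAt_log_left (p : ℂ) (y x : ℝ) (h : x - p.re < 0) :
    HasDerivAt (fun y : ℝ => log (-(x + y * I - p))) (I * (x + y * I - p)⁻¹) y := by
  have h0 : HasDerivAt (fun y : ℝ => (x : ℂ) + y * I - p) I y := by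
    simpa using ((((hasDerivAt_id y).ofReal_comp).mul_const I).const_add (x : ℂ)).sub_const p
  have h1 : HasDerivAt (fun y : ℝ => -((x : ℂ) + y * I - p)) (-I) y := h0.fun_neg
  have := h1.clog_real (Or.inl (by simpa using h))
  convert this using 1
  rw [neg_div_neg_eq, div_eq_mul_inv]

theorem log_neg_of_im_pos {z : ℂ} (h : 0 < z.im) : log (-z) = log z - Real.pi * I := by
  apply Complex.ext <;> simp [log_re, log_im, arg_neg_eq_arg_sub_pi_of_im_pos h]

theorem log_neg_of_im_neg {z : ℂ} (h : z.im < 0) : log (-z) = log z + Real.pi * I := by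
  apply Complex.ext <;> simp [log_re, log_im, arg_neg_eq_arg_add_pi_of_im_neg h]

/-- Three sides share the primitive log(z - p), and their corner values cancel. The left side uses
log(-(z - p)), which differs by -πi at the upper corner and by +πi at the lower one; this mismatch
is the 2πi. -/
theorem rectIntegral_inv_sub {p : ℂ} {x₀ x₁ y₀ y₁ : ℝ} (hp : p ∈ Ioo x₀ x₁ ×ℂ Ioo y₀ y₁) :
    rectIntegral (fun z => (z - p)⁻¹) x₀ x₁ y₀ y₁ = 2 * Real.pi * I := by
  obtain ⟨⟨h1, h2⟩, h3, h4⟩ := hp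
  have ne_of_im : ∀ y : ℝ, y - p.im ≠ 0 → ∀ x : ℝ, (x : ℂ) + y * I - p ≠ 0 := by
    intro y hy x h; apply hy; simpa using congrArg Complex.im h
  have ne_of_re : ∀ x : ℝ, x - p.re ≠ 0 → ∀ y : ℝ, (x : ℂ) + y * I - p ≠ 0 := by
    intro x hx y h; apply hx; simpa using congrArg Complex.re h
  have hH : ∀ y : ℝ, y - p.im ≠ 0 → ∫ x : ℝ in x₀..x₁, ((x : ℂ) + y * I - p)⁻¹ =
      log (x₁ + y * I - p) - log (x₀ + y * I - p) := fun y hy =>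
    intervalIntegral.integral_eq_sub_of_hasDerivAt
      (fun x _ => hasDerivAt_log_horizontal p y x hy)
      (Continuous.intervalIntegrable
        (Continuous.inv₀ (by fun_prop) (ne_of_im y hy)) _ _)
  have hR : ∫ y : ℝ in y₀..y₁, I * ((x₁ : ℂ) + y * I - p)⁻¹ =
      log (x₁ + y₁ * I - p) - log (x₁ + y₀ * I - p) :=
    intervalIntegral.integral_eq_sub_of_hasDerivAt
      (fun y _ => hasDerivAt_log_right p y x₁ (by linarith))
      (Continuous.intervalIntegrable
        (continuous_const.mul (Continuous.inv₀ (by fun_prop) (ne_of_re x₁ (by linarith)))) _ _)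
  have hL : ∫ y : ℝ in y₀..y₁, I * ((x₀ : ℂ) + y * I - p)⁻¹ =
      log (-(x₀ + y₁ * I - p)) - log (-(x₀ + y₀ * I - p)) :=
    intervalIntegral.integral_eq_sub_of_hasDerivAt
      (fun y _ => hasDerivAt_log_left p y x₀ (by linarith))
      (Continuous.intervalIntegrable
        (continuous_const.mul (Continuous.inv₀ (by fun_prop) (ne_of_re x₀ (by linarith)))) _ _)
  rw [intervalIntegral.integral_const_mul] at hR hL
  rw [rectIntegral, hH y₀ (by linarith), hH y₁ (by linarith), hR, hL,
    log_neg_of_im_pos (z := x₀ + y₁ * I - p) (by simpa using h4),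
    log_neg_of_im_neg (z := x₀ + y₀ * I - p) (by simpa using h3)]
  ring

/-- If `f` is continuous off a subset `S` of the open rectangle, it is integrable on the four sides,
so the rectangle integral of a difference is the difference. -/
theorem rectIntegral_sub {f g : ℂ → ℂ} {x₀ x₁ y₀ y₁ : ℝ} {S : Set ℂ} (hx : x₀ ≤ x₁) (hy : y₀ ≤ y₁)
    (hS : S ⊆ Ioo x₀ x₁ ×ℂ Ioo y₀ y₁)
    (hf : ContinuousOn f ((Icc x₀ x₁ ×ℂ Icc y₀ y₁) \ S))
    (hg : ContinuousOn g ((Icc x₀ x₁ ×ℂ Icc y₀ y₁) \ S)) :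
    rectIntegral (fun z => f z - g z) x₀ x₁ y₀ y₁ =
      rectIntegral f x₀ x₁ y₀ y₁ - rectIntegral g x₀ x₁ y₀ y₁ := by
  have hH : ∀ h : ℂ → ℂ, ContinuousOn h ((Icc x₀ x₁ ×ℂ Icc y₀ y₁) \ S) → ∀ y : ℝ, y = y₀ ∨ y = y₁ →
      IntervalIntegrable (fun x : ℝ => h (x + y * I)) MeasureTheory.volume x₀ x₁ := by
    intro h hh y hy'
    refine ContinuousOn.intervalIntegrable (hh.comp (by fun_prop) ?_)
    intro x hx'
    rw [uIcc_of_le hx] at hx'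
    refine ⟨⟨by simpa using hx', ?_⟩, fun hs => ?_⟩
    · rcases hy' with rfl | rfl <;> simp [hy]
    · have := (hS hs).2
      rcases hy' with rfl | rfl <;> simp at this
  have hV : ∀ h : ℂ → ℂ, ContinuousOn h ((Icc x₀ x₁ ×ℂ Icc y₀ y₁) \ S) → ∀ x : ℝ, x = x₀ ∨ x = x₁ →
      IntervalIntegrable (fun y : ℝ => h (x + y * I)) MeasureTheory.volume y₀ y₁ := by
    intro h hh x hx'
    refine ContinuousOn.intervalIntegrable (hh.comp (by fun_prop) ?_)
    intro y hy'
    rw [uIcc_of_le hy] at hy'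
    refine ⟨⟨?_, by simpa using hy'⟩, fun hs => ?_⟩
    · rcases hx' with rfl | rfl <;> simp [hx]
    · have := (hS hs).1
      rcases hx' with rfl | rfl <;> simp at this
  unfold rectIntegral
  rw [intervalIntegral.integral_sub (hH f hf _ (Or.inl rfl)) (hH g hg _ (Or.inl rfl)),
    intervalIntegral.integral_sub (hH f hf _ (Or.inr rfl)) (hH g hg _ (Or.inr rfl)),
    intervalIntegral.integral_sub (hV f hf _ (Or.inl rfl)) (hV g hg _ (Or.inl rfl)),
    intervalIntegral.integral_sub (hV f hf _ (Or.inr rfl)) (hV g hg _ (Or.inr rfl))]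
  ring

theorem rectIntegral_update {f : ℂ → ℂ} {x₀ x₁ y₀ y₁ : ℝ} {p c : ℂ}
    (hp : p ∈ Ioo x₀ x₁ ×ℂ Ioo y₀ y₁) :
    rectIntegral (Function.update f p c) x₀ x₁ y₀ y₁ = rectIntegral f x₀ x₁ y₀ y₁ := by
  obtain ⟨⟨h1, h2⟩, h3, h4⟩ := hp
  have hi : ∀ y : ℝ, y ≠ p.im → ∀ x : ℝ, Function.update f p c (x + y * I) = f (x + y * I) := by
    intro y hy x
    refine Function.update_of_ne (fun h => hy ?_) _ _
    simpa using congrArg Complex.im h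
  have hr : ∀ x : ℝ, x ≠ p.re → ∀ y : ℝ, Function.update f p c (x + y * I) = f (x + y * I) := by
    intro x hx y
    refine Function.update_of_ne (fun h => hx ?_) _ _
    simpa using congrArg Complex.re h
  simp only [rectIntegral, hi y₀ h3.ne, hi y₁ h4.ne', hr x₀ h1.ne, hr x₁ h2.ne']

/-- The residue theorem on a rectangle, for finitely many simple poles. -/
theorem rectIntegral_eq_sum_residues {x₀ x₁ y₀ y₁ : ℝ} (hx : x₀ ≤ x₁) (hy : y₀ ≤ y₁)
    (S : Finset ℂ) (r : ℂ → ℂ) : ∀ f : ℂ → ℂ, (S : Set ℂ) ⊆ Ioo x₀ x₁ ×ℂ Ioo y₀ y₁ →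
    DifferentiableOn ℂ f ((Icc x₀ x₁ ×ℂ Icc y₀ y₁) \ S) →
    (∀ p ∈ S, Tendsto (fun z => (z - p) * f z) (𝓝[≠] p) (𝓝 (r p))) →
    rectIntegral f x₀ x₁ y₀ y₁ = 2 * Real.pi * I * ∑ p ∈ S, r p := by
  classical
  induction S using Finset.induction_on with
  | empty =>
    intro f _ hf _
    simpa using rectIntegral_eq_zero hx hy (by simpa using hf)
  | insert p S hpS ih =>
    intro f hS hf hr
    set Q := Icc x₀ x₁ ×ℂ Icc y₀ y₁ with hQ
    have hpI : p ∈ Ioo x₀ x₁ ×ℂ Ioo y₀ y₁ := hS (by simp)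
    have hopen : IsOpen (Ioo x₀ x₁ ×ℂ Ioo y₀ y₁) := isOpen_Ioo.reProdIm isOpen_Ioo
    have hsub : Ioo x₀ x₁ ×ℂ Ioo y₀ y₁ ⊆ Q := fun z hz =>
      ⟨Ioo_subset_Icc_self hz.1, Ioo_subset_Icc_self hz.2⟩
    have hdinv : DifferentiableOn ℂ (fun z => r p * (z - p)⁻¹) (Q \ {p}) := by
      intro z hz
      exact ((differentiableAt_id.sub_const p).inv (sub_ne_zero.mpr hz.2)).const_mul (r p)
        |>.differentiableWithinAt
    -- Removing the principal part at p leaves a removable singularity. After redefining the value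
    -- at p, the induction hypothesis applies with the remaining poles.
    set h : ℂ → ℂ := fun z => f z - r p * (z - p)⁻¹ with hh
    have hSc : (Q \ (S : Set ℂ)) \ {p} = Q \ ((insert p S : Finset ℂ) : Set ℂ) := by
      ext z; simp only [Finset.coe_insert, Set.mem_sdiff, mem_singleton_iff, mem_insert_iff]; tauto
    have hhd : DifferentiableOn ℂ h ((Q \ (S : Set ℂ)) \ {p}) := by
      refine DifferentiableOn.sub (by rwa [hSc]) (hdinv.mono ?_)
      exact fun z hz => ⟨hz.1.1, hz.2⟩
    have hnhds : Q \ (S : Set ℂ) ∈ 𝓝 p :=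
      Filter.inter_mem (mem_of_superset (hopen.mem_nhds hpI) hsub)
        (S.finite_toSet.isClosed.isOpen_compl.mem_nhds (by simpa using hpS))
    have hlim : Tendsto (fun z => (z - p) * h z) (𝓝[≠] p) (𝓝 0) := by
      have := (hr p (by simp)).sub_const (r p)
      rw [sub_self] at this
      refine this.congr' ?_
      filter_upwards [self_mem_nhdsWithin] with z hz
      have hz' : z - p ≠ 0 := sub_ne_zero.mpr hz
      simp only [hh]; field_simp
    have ho : (fun z => h z - h p) =o[𝓝[≠] p] fun z => (z - p)⁻¹ := by
      rw [Asymptotics.isLittleO_iff_tendsto']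
      · have h2 : Tendsto (fun z : ℂ => (z - p) * h p) (𝓝[≠] p) (𝓝 0) := by
          have : Tendsto (fun z : ℂ => (z - p) * h p) (𝓝 p) (𝓝 ((p - p) * h p)) :=
            Continuous.tendsto (by fun_prop) p
          simpa using this.mono_left nhdsWithin_le_nhds
        have := hlim.sub h2
        rw [sub_zero] at this
        refine this.congr fun z => ?_
        rw [div_inv_eq_mul]; ring
      · filter_upwards [self_mem_nhdsWithin] with z hz h0
        exact absurd (inv_eq_zero.mp h0) (sub_ne_zero.mpr hz)
    have hupd := differentiableOn_update_limUnder_of_isLittleO hnhds hhd ho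
    have key := ih _ (fun z hz => hS (by simp [hz])) hupd ?_
    · rw [rectIntegral_update hpI] at key
      have hsplit := rectIntegral_sub (f := f) (g := fun z => r p * (z - p)⁻¹) hx hy hS
        hf.continuousOn (hdinv.continuousOn.mono fun z hz => ⟨hz.1, fun h => hz.2 (by simp_all)⟩)
      have hc : rectIntegral (fun z => r p * (z - p)⁻¹) x₀ x₁ y₀ y₁ =
          r p * rectIntegral (fun z => (z - p)⁻¹) x₀ x₁ y₀ y₁ := by
        simp only [rectIntegral, intervalIntegral.integral_const_mul]; ring
      rw [hc, rectIntegral_inv_sub hpI] at hsplit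
      rw [Finset.sum_insert hpS]
      linear_combination key - hsplit
    · intro q hq
      have hqp : q ≠ p := fun h => hpS (h ▸ hq)
      have h1 := hr q (by simp [hq])
      -- The subtracted principal part is regular at q ≠ p, so the residue there is unaffected.
      have h2 : Tendsto (fun z => (z - q) * (r p * (z - p)⁻¹)) (𝓝[≠] q) (𝓝 0) := by
        have hc : ContinuousAt (fun z => (z - q) * (r p * (z - p)⁻¹)) q :=
          (by fun_prop : ContinuousAt (fun z : ℂ => z - q) q).mul
            (continuousAt_const.mul (ContinuousAt.inv₀ (by fun_prop) (sub_ne_zero.mpr hqp)))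
        have := hc.tendsto
        simp only [sub_self, zero_mul] at this
        exact this.mono_left nhdsWithin_le_nhds
      have h3 := h1.sub h2
      rw [sub_zero] at h3
      refine h3.congr' ?_
      filter_upwards [nhdsWithin_le_nhds (isOpen_ne.mem_nhds hqp)] with z hz
      rw [Function.update_of_ne hz]; simp only [hh]; ring

/-- The integral of `1 / E` over the boundary of a rectangle when `E` has simple zeros. -/
theorem rectIntegral_inv_eq_sum {x₀ x₁ y₀ y₁ : ℝ} (hx : x₀ ≤ x₁) (hy : y₀ ≤ y₁)
    {S : Finset ℂ} {E E' : ℂ → ℂ} (hS : (S : Set ℂ) ⊆ Ioo x₀ x₁ ×ℂ Ioo y₀ y₁)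
    (hE : Differentiable ℂ E) (h0 : ∀ z ∈ Icc x₀ x₁ ×ℂ Icc y₀ y₁, E z = 0 → z ∈ S)
    (hz : ∀ p ∈ S, E p = 0) (hd : ∀ p ∈ S, HasDerivAt E (E' p) p) (hd0 : ∀ p ∈ S, E' p ≠ 0) :
    rectIntegral (fun z => (E z)⁻¹) x₀ x₁ y₀ y₁ = 2 * Real.pi * I * ∑ p ∈ S, (E' p)⁻¹ := by
  refine rectIntegral_eq_sum_residues hx hy S (fun p => (E' p)⁻¹) _ hS ?_ ?_
  · intro z hz'
    exact ((hE z).inv fun h => hz'.2 (h0 z hz'.1 h)).differentiableWithinAt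
  · intro p hp
    have := (hasDerivAt_iff_tendsto_slope.mp (hd p hp)).inv₀ (hd0 p hp)
    refine this.congr fun z => ?_
    rw [slope_def_field, hz p hp, sub_zero, inv_div, div_eq_mul_inv]

end Residues

/-! ### Exponential substitution and differentiation under the integral. -/

section HyperbolicKernel

open Real MeasureTheory Set Filter Topology

theorem integrable_exp_neg_mul_abs {b : ℝ} (hb : 0 < b) :
    Integrable (fun t : ℝ => exp (-(b * |t|))) := by
  rw [← integrableOn_univ, ← Iic_union_Ioi (a := (0 : ℝ))]
  refine IntegrableOn.union ?_ ?_
  · refine (integrableOn_exp_mul_Iic hb 0).congr_fun (fun t ht => ?_) measurableSet_Iic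
    simp [abs_of_nonpos (mem_Iic.mp ht)]
  · refine (integrableOn_exp_mul_Ioi (neg_lt_zero.mpr hb) 0).congr_fun (fun t ht => ?_)
      measurableSet_Ioi
    simp [abs_of_pos (mem_Ioi.mp ht)]

theorem cosh_add_pos {c : ℝ} (hc : -1 < c) (t : ℝ) : 0 < cosh t + c := by
  linarith [one_le_cosh t]

theorem inv_cosh_add_le {c : ℝ} (hc : -1 < c) (hc1 : c ≤ 1) (t : ℝ) :
    (cosh t + c)⁻¹ ≤ 4 / (1 + c) * exp (-|t|) := by
  have h1 : exp |t| ≤ 2 * cosh t := by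
    rw [← cosh_abs, cosh_eq]; linarith [exp_pos (-|t|)]
  -- Since c ≤ 1 and cosh t ≥ 1, cosh t + c ≥ (1+c)/2 · cosh t; the other factor ½ comes from
  -- e^{|t|} ≤ 2 cosh t.
  have h2 : (1 + c) / 4 * exp |t| ≤ cosh t + c := by
    nlinarith [one_le_cosh t]
  have h3 : 0 < (1 + c) / 4 * exp |t| := by
    have := exp_pos |t|
    have : 0 < 1 + c := by linarith
    positivity
  calc (cosh t + c)⁻¹ ≤ ((1 + c) / 4 * exp |t|)⁻¹ := inv_anti₀ h3 h2
    _ = 4 / (1 + c) * exp (-|t|) := by rw [mul_inv, inv_div, exp_neg]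

theorem continuous_inv_cosh_add {c : ℝ} (hc : -1 < c) :
    Continuous fun t : ℝ => (cosh t + c)⁻¹ :=
  Continuous.inv₀ (by fun_prop) fun t => (cosh_add_pos hc t).ne'

theorem integrable_inv_cosh_add {c : ℝ} (hc : -1 < c) (hc1 : c ≤ 1) :
    Integrable fun t : ℝ => (cosh t + c)⁻¹ := by
  have h := (integrable_exp_neg_mul_abs one_pos).const_mul (4 / (1 + c))
  refine h.mono' (continuous_inv_cosh_add hc).aestronglyMeasurable (ae_of_all _ fun t => ?_)
  rw [norm_of_nonneg (inv_nonneg.mpr (cosh_add_pos hc t).le), one_mul]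
  exact inv_cosh_add_le hc hc1 t

theorem continuous_inv_one_add_exp (α L : ℝ) :
    Continuous fun t : ℝ => (1 + exp (-(α * (t - L))))⁻¹ :=
  Continuous.inv₀ (by fun_prop) fun _ => by positivity

theorem inv_one_add_exp_le_one (u : ℝ) : (1 + exp u)⁻¹ ≤ 1 :=
  inv_le_one_of_one_le₀ (by linarith [exp_pos u])

theorem integrable_logistic_mul_inv_cosh_add {c : ℝ} (hc : -1 < c) (hc1 : c ≤ 1) (α L : ℝ) :
    Integrable fun t : ℝ => (1 + exp (-(α * (t - L))))⁻¹ * (cosh t + c)⁻¹ := by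
  refine (integrable_inv_cosh_add hc hc1).mono'
    ((continuous_inv_one_add_exp α L).mul (continuous_inv_cosh_add hc)).aestronglyMeasurable
    (ae_of_all _ fun t => ?_)
  have h0 := inv_nonneg.mpr (cosh_add_pos hc t).le
  rw [norm_of_nonneg (mul_nonneg (by positivity) h0)]
  exact mul_le_of_le_one_left h0 (inv_one_add_exp_le_one _)

theorem log_one_add_exp_nonneg (u : ℝ) : 0 ≤ log (1 + exp u) :=
  log_nonneg (by linarith [exp_pos u])

/-- The growth is only linear in |t|; the rate e^{|t|/2} is chosen so that the product with the
kernel, of order e^{-|t|}, stays integrable. -/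
theorem log_one_add_exp_mul_le {α t : ℝ} (h0 : 0 < α) (h2 : α ≤ 2) :
    log (1 + exp (α * t)) ≤ 4 * exp (|t| / 2) := by
  have h3 : α * t ≤ 2 * |t| := by
    nlinarith [le_abs_self t, abs_nonneg t]
  have h4 : 1 + exp (α * t) ≤ 2 * exp (2 * |t|) := by
    have := exp_le_exp.mpr h3
    have := one_le_exp (by positivity : 0 ≤ 2 * |t|)
    linarith
  calc log (1 + exp (α * t)) ≤ log (2 * exp (2 * |t|)) :=
        log_le_log (by positivity) h4
    _ = log 2 + 2 * |t| := by rw [log_mul (by norm_num) (exp_pos _).ne', log_exp]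
    _ ≤ 4 * exp (|t| / 2) := by
        linarith [add_one_le_exp (|t| / 2), log_two_lt_d9]

theorem integrable_log_div_cosh_add_zero {c α : ℝ} (hc : -1 < c) (hc1 : c ≤ 1) (h0 : 0 < α)
    (h2 : α ≤ 2) :
    Integrable fun t : ℝ => log (1 + exp (α * t)) * (cosh t + c)⁻¹ := by
  have h := (integrable_exp_neg_mul_abs one_half_pos).const_mul (4 * (4 / (1 + c)))
  refine h.mono' (Continuous.aestronglyMeasurable
    ((Continuous.log (by fun_prop) fun _ => by positivity).mul (continuous_inv_cosh_add hc)))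
    (ae_of_all _ fun t => ?_)
  have hk := inv_nonneg.mpr (cosh_add_pos hc t).le
  rw [norm_of_nonneg (mul_nonneg (log_one_add_exp_nonneg _) hk)]
  calc log (1 + exp (α * t)) * (cosh t + c)⁻¹
      ≤ (4 * exp (|t| / 2)) * (4 / (1 + c) * exp (-|t|)) :=
        mul_le_mul (log_one_add_exp_mul_le h0 h2) (inv_cosh_add_le hc hc1 t) hk (by positivity)
    _ = 4 * (4 / (1 + c)) * exp (-(1 / 2 * |t|)) := by
        rw [show -(1 / 2 * |t|) = |t| / 2 + -|t| by ring, exp_add]; ring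

theorem log_one_add_exp_sub_le {α L : ℝ} (h0 : 0 < α) (hL : 0 ≤ L) (t : ℝ) :
    log (1 + exp (α * (t - L))) ≤ log (1 + exp (α * t)) := by
  refine log_le_log (by positivity) ?_
  gcongr
  linarith

theorem continuous_log_div_cosh_add {c : ℝ} (hc : -1 < c) (α L : ℝ) :
    Continuous fun t : ℝ => log (1 + exp (α * (t - L))) * (cosh t + c)⁻¹ :=
  (Continuous.log (by fun_prop) fun _ => by positivity).mul (continuous_inv_cosh_add hc)

theorem norm_log_div_cosh_add_le {c α L : ℝ} (hc : -1 < c) (h0 : 0 < α) (hL : 0 ≤ L) (t : ℝ) :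
    ‖log (1 + exp (α * (t - L))) * (cosh t + c)⁻¹‖ ≤ log (1 + exp (α * t)) * (cosh t + c)⁻¹ := by
  have hk := inv_nonneg.mpr (cosh_add_pos hc t).le
  rw [norm_of_nonneg (mul_nonneg (log_one_add_exp_nonneg _) hk)]
  exact mul_le_mul_of_nonneg_right (log_one_add_exp_sub_le h0 hL t) hk

theorem integrable_log_div_cosh_add {c α L : ℝ} (hc : -1 < c) (hc1 : c ≤ 1) (h0 : 0 < α)
    (h2 : α ≤ 2) (hL : 0 ≤ L) :
    Integrable fun t : ℝ => log (1 + exp (α * (t - L))) * (cosh t + c)⁻¹ :=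
  (integrable_log_div_cosh_add_zero hc hc1 h0 h2).mono'
    (continuous_log_div_cosh_add hc α L).aestronglyMeasurable
    (ae_of_all _ (norm_log_div_cosh_add_le hc h0 hL))

/-- The integrand decreases in L, so its value at L = 0 dominates for all L ≥ 0. -/
theorem tendsto_integral_log_div_cosh_add {c α : ℝ} (hc : -1 < c) (hc1 : c ≤ 1) (h0 : 0 < α)
    (h2 : α ≤ 2) :
    Tendsto (fun L : ℝ => ∫ t : ℝ, log (1 + exp (α * (t - L))) * (cosh t + c)⁻¹) atTop (𝓝 0) := by
  rw [← integral_zero ℝ ℝ]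
  refine tendsto_integral_filter_of_dominated_convergence _
    (Eventually.of_forall fun L => (continuous_log_div_cosh_add hc α L).aestronglyMeasurable)
    ((eventually_ge_atTop 0).mono fun L hL => ae_of_all _ (norm_log_div_cosh_add_le hc h0 hL))
    (integrable_log_div_cosh_add_zero hc hc1 h0 h2) (ae_of_all _ fun t => ?_)
  have h1 : Tendsto (fun L : ℝ => α * (t - L)) atTop atBot :=
    (tendsto_atBot_add_const_left _ t tendsto_neg_atTop_atBot).const_mul_atBot h0
  have h3 : Tendsto (fun L : ℝ => 1 + exp (α * (t - L))) atTop (𝓝 (1 + 0)) :=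
    (tendsto_exp_atBot.comp h1).const_add 1
  have h4 := (h3.log (by norm_num)).mul_const (cosh t + c)⁻¹
  simpa using h4

/-- The derivative of log(1 + e^u) is the logistic function, which is at most 1, so α times the
kernel dominates uniformly in L. -/
theorem hasDerivAt_integral_log_div_cosh_add {c α L : ℝ} (hc : -1 < c) (hc1 : c ≤ 1) (h0 : 0 < α)
    (h2 : α ≤ 2) (hL : 0 < L) :
    HasDerivAt (fun L : ℝ => ∫ t : ℝ, log (1 + exp (α * (t - L))) * (cosh t + c)⁻¹)
      (-α * ∫ t : ℝ, (1 + exp (-(α * (t - L))))⁻¹ * (cosh t + c)⁻¹) L := by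
  rw [← integral_const_mul]
  refine (hasDerivAt_integral_of_dominated_loc_of_deriv_le (s := univ)
    (bound := fun t => α * (cosh t + c)⁻¹) univ_mem
    (Eventually.of_forall fun L => (continuous_log_div_cosh_add hc α L).aestronglyMeasurable)
    (integrable_log_div_cosh_add hc hc1 h0 h2 hL.le)
    (F' := fun L t => -α * ((1 + exp (-(α * (t - L))))⁻¹ * (cosh t + c)⁻¹))
    ((integrable_logistic_mul_inv_cosh_add hc hc1 α L).const_mul _).aestronglyMeasurable
    (ae_of_all _ fun t M _ => ?_) ((integrable_inv_cosh_add hc hc1).const_mul α)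
    (ae_of_all _ fun t M _ => ?_)).2
  · have hk := inv_nonneg.mpr (cosh_add_pos hc t).le
    rw [norm_mul, norm_neg, norm_of_nonneg h0.le, norm_of_nonneg (mul_nonneg (by positivity) hk)]
    gcongr
    exact mul_le_of_le_one_left hk (inv_one_add_exp_le_one _)
  · have h1 : HasDerivAt (fun M : ℝ => α * (t - M)) (-α) M := by
      simpa using ((hasDerivAt_id M).const_sub t).const_mul α
    have h3 := ((h1.exp.const_add 1).log (by positivity)).mul_const (cosh t + c)⁻¹
    refine h3.congr_deriv ?_
    rw [exp_neg]
    have := exp_pos (α * (t - M))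
    field_simp
    ring

/-- The leading factor is the Jacobian of x = e^{t-L}. With β = e^{-L}, the quadratic denominator is
2xβ(cosh t + cos πρ). -/
theorem stableGIntegrand_exp {α ρ L t : ℝ} (hc : -1 < cos (π * ρ)) :
    |exp (t - L)| • stableGIntegrand α ρ (exp (-L)) (exp (t - L)) =
      log (1 + exp (α * (t - L))) * (cosh t + cos (π * ρ))⁻¹ / 2 := by
  have hp := cosh_add_pos hc t
  rw [abs_of_pos (exp_pos _), smul_eq_mul, stableGIntegrand, ← exp_mul, mul_comm (t - L) α]
  have hden : exp (t - L) ^ 2 + 2 * exp (t - L) * exp (-L) * cos (π * ρ) + exp (-L) ^ 2 =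
      2 * exp (t - L) * exp (-L) * (cosh t + cos (π * ρ)) := by
    rw [cosh_eq, sub_eq_add_neg, exp_add, exp_neg t]
    have := exp_pos t
    field_simp
    ring
  rw [hden]
  have h1 := exp_pos (t - L)
  have h2 := exp_pos (-L)
  field_simp

theorem image_exp_sub (L : ℝ) : (fun t : ℝ => exp (t - L)) '' univ = Ioi 0 := by
  ext x
  simp only [image_univ, mem_range, mem_Ioi]
  refine ⟨fun ⟨t, ht⟩ => ht ▸ exp_pos _, fun hx => ⟨log x + L, ?_⟩⟩
  rw [add_sub_cancel_right, exp_log hx]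

theorem integrableOn_stableGIntegrand_and_stableG_eq {α ρ L : ℝ} (hc : -1 < cos (π * ρ))
    (h0 : 0 < α) (h2 : α ≤ 2) (hL : 0 ≤ L) :
    IntegrableOn (stableGIntegrand α ρ (exp (-L))) (Ioi 0) ∧
    stableG α ρ (exp (-L)) = sin (π * ρ) / (2 * π) *
      ∫ t : ℝ, log (1 + exp (α * (t - L))) * (cosh t + cos (π * ρ))⁻¹ := by
  have hd : ∀ t ∈ (univ : Set ℝ),
      HasDerivWithinAt (fun t : ℝ => exp (t - L)) (exp (t - L)) univ t := fun t _ => by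
    have h : HasDerivAt (fun t : ℝ => exp (t - L)) (exp (t - L)) t := by
      simpa using ((hasDerivAt_id t).sub_const L).exp
    exact h.hasDerivWithinAt
  have hinj : InjOn (fun t : ℝ => exp (t - L)) univ := fun x _ y _ h => by
    have := exp_injective h; linarith
  constructor
  · rw [← image_exp_sub L, integrableOn_image_iff_integrableOn_abs_deriv_smul MeasurableSet.univ
      hd hinj]
    simp only [stableGIntegrand_exp hc, integrableOn_univ]
    exact (integrable_log_div_cosh_add hc (cos_le_one _) h0 h2 hL).div_const 2
  · rw [stableG, ← image_exp_sub L, integral_image_eq_integral_abs_deriv_smul MeasurableSet.univ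
      hd hinj]
    simp only [stableGIntegrand_exp hc, Measure.restrict_univ, integral_div]
    ring

end HyperbolicKernel

/-! ### The contour integrand, its zeros and its residues. -/

section Contour

open Complex MeasureTheory Set Filter Topology

/-- `1 + (-1)^n e^w`, the building block of the contour integrand. -/
noncomputable def signedOneAddExp (n : ℕ) (w : ℂ) : ℂ := 1 + (-1) ^ n * exp w

theorem hasDerivAt_signedOneAddExp (n : ℕ) (w : ℂ) :
    HasDerivAt (signedOneAddExp n) ((-1) ^ n * exp w) w :=
  ((Complex.hasDerivAt_exp w).const_mul _).const_add _

theorem neg_one_pow_eq_exp (n : ℕ) : (-1 : ℂ) ^ n = exp (n * (Real.pi * I)) := by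
  rw [exp_nat_mul, exp_pi_mul_I]

/-- A shift by nπi multiplies e^w by (-1)^n and cancels the built-in sign; this is what those signs
are for. -/
theorem signedOneAddExp_add_pi (n : ℕ) (w : ℂ) :
    signedOneAddExp n (w + n * (Real.pi * I)) = 1 + exp w := by
  rw [signedOneAddExp, exp_add, ← neg_one_pow_eq_exp]
  have : (-1 : ℂ) ^ n * (-1) ^ n = 1 := by rw [← mul_pow]; simp
  linear_combination exp w * this

theorem signedOneAddExp_sub_pi (n : ℕ) (w : ℂ) :
    signedOneAddExp n (w - n * (Real.pi * I)) = 1 + exp w := by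
  rw [← signedOneAddExp_add_pi n w, signedOneAddExp, signedOneAddExp]
  have : w + n * (Real.pi * I) = w - n * (Real.pi * I) + n * (2 * Real.pi * I) := by ring
  rw [this, exp_add _ (n * (2 * Real.pi * I)), exp_nat_mul_two_pi_mul_I, mul_one]

theorem signedOneAddExp_eq_zero_iff (n : ℕ) (w : ℂ) :
    signedOneAddExp n w = 0 ↔ ∃ m : ℤ, w = ((n : ℂ) - 1 - 2 * m) * (Real.pi * I) := by
  have h1 : signedOneAddExp n w = 0 ↔ exp (n * (Real.pi * I) + w) = exp (Real.pi * I) := by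
    rw [signedOneAddExp, exp_add, ← neg_one_pow_eq_exp, exp_pi_mul_I, add_comm,
      add_eq_zero_iff_eq_neg]
  rw [h1, exp_eq_exp_iff_exists_int]
  constructor
  · rintro ⟨m, hm⟩
    refine ⟨n - 1 - m, ?_⟩
    push_cast
    linear_combination hm
  · rintro ⟨m, hm⟩
    refine ⟨n - 1 - m, ?_⟩
    push_cast
    linear_combination hm

/-- The reverse triangle inequality, with a bound that depends only on the real part. It confines
the zeros to the imaginary axis and controls the vertical sides. -/
theorem norm_signedOneAddExp_ge (n : ℕ) (w : ℂ) :
    |Real.exp w.re - 1| ≤ ‖signedOneAddExp n w‖ := by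
  have h := abs_norm_sub_norm_le ((-1) ^ n * exp w) (-1)
  have h2 : (-1) ^ n * exp w - -1 = signedOneAddExp n w := by rw [signedOneAddExp]; ring
  rw [h2] at h
  simpa [norm_exp] using h

theorem signedOneAddExp_ne_zero {n : ℕ} {w : ℂ} (h : w.re ≠ 0) : signedOneAddExp n w ≠ 0 := by
  intro h0
  have := norm_signedOneAddExp_ge n w
  rw [h0, norm_zero] at this
  have h1 := abs_nonpos_iff.mp this
  exact h (by rwa [sub_eq_zero, Real.exp_eq_one_iff] at h1)

/-- The denominator `(1 + (-1)^l e^{-α(z-L)}) (1 + (-1)^k e^z)`. -/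
noncomputable def contourDenom (α L : ℝ) (k l : ℕ) (z : ℂ) : ℂ :=
  signedOneAddExp l (-(α * (z - L))) * signedOneAddExp k z

/-- The zeros of the first factor of `contourDenom`. -/
noncomputable def zeroLeft (α L : ℝ) (l j : ℕ) : ℂ :=
  L + ((l : ℂ) - 1 - 2 * j) * (Real.pi * I) / α

/-- The zeros of the second factor of `contourDenom`. -/
noncomputable def zeroRight (k j : ℕ) : ℂ := ((k : ℂ) - 1 - 2 * j) * (Real.pi * I)

theorem zeroLeft_re (α L : ℝ) (l j : ℕ) : (zeroLeft α L l j).re = L := by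
  simp [zeroLeft, div_ofReal_re]

theorem zeroRight_re (k j : ℕ) : (zeroRight k j).re = 0 := by simp [zeroRight]

theorem zeroLeft_im (α L : ℝ) (l j : ℕ) :
    (zeroLeft α L l j).im = ((l : ℝ) - 1 - 2 * j) * Real.pi / α := by
  simp [zeroLeft, div_ofReal_im]

theorem zeroRight_im (k j : ℕ) : (zeroRight k j).im = ((k : ℝ) - 1 - 2 * j) * Real.pi := by
  simp [zeroRight]

theorem hasDerivAt_contourDenom (α L : ℝ) (k l : ℕ) (z : ℂ) :
    HasDerivAt (contourDenom α L k l)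
      ((-1) ^ l * exp (-(α * (z - L))) * -α * signedOneAddExp k z +
        signedOneAddExp l (-(α * (z - L))) * ((-1) ^ k * exp z)) z := by
  have h1 : HasDerivAt (fun z : ℂ => -((α : ℂ) * (z - L))) (-α) z := by
    have := (((hasDerivAt_id z).sub_const (L : ℂ)).const_mul (α : ℂ)).fun_neg
    simpa using this
  exact ((hasDerivAt_signedOneAddExp l _).comp z h1).mul (hasDerivAt_signedOneAddExp k z)

theorem signedOneAddExp_zeroLeft {α : ℝ} (hα : 0 < α) (L : ℝ) (l j : ℕ) :
    signedOneAddExp l (-(α * (zeroLeft α L l j - L))) = 0 := by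
  rw [signedOneAddExp_eq_zero_iff]
  refine ⟨l - 1 - j, ?_⟩
  have : (α : ℂ) ≠ 0 := by exact_mod_cast hα.ne'
  rw [zeroLeft]; push_cast; field_simp; ring

theorem signedOneAddExp_zeroRight (k j : ℕ) : signedOneAddExp k (zeroRight k j) = 0 := by
  rw [signedOneAddExp_eq_zero_iff]
  exact ⟨j, by simp [zeroRight]⟩

theorem exists_zeroLeft {α L : ℝ} (hα : 0 < α) {l : ℕ} {z : ℂ}
    (h : signedOneAddExp l (-(α * (z - L))) = 0) (hz : |z.im| ≤ Real.pi * (l / α)) :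
    ∃ j ∈ Finset.range l, zeroLeft α L l j = z := by
  obtain ⟨m, hm⟩ := (signedOneAddExp_eq_zero_iff _ _).mp h
  have hα' : (α : ℂ) ≠ 0 := by exact_mod_cast hα.ne'
  have him : α * z.im = -(((l : ℝ) - 1 - 2 * m) * Real.pi) := by
    have := congrArg Complex.im hm
    simp at this
    linarith
  have hb : |(l : ℝ) - 1 - 2 * m| ≤ l := by
    have h1 : |α * z.im| ≤ l * Real.pi := by
      rw [abs_mul, abs_of_pos hα]
      calc α * |z.im| ≤ α * (Real.pi * (l / α)) := by gcongr
        _ = l * Real.pi := by field_simp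
    rw [him, abs_neg, abs_mul, abs_of_pos Real.pi_pos] at h1
    exact le_of_mul_le_mul_right h1 Real.pi_pos
  rw [abs_le] at hb
  have hb1 : -(l : ℤ) ≤ l - 1 - 2 * m := by exact_mod_cast hb.1
  have hb2 : (l : ℤ) - 1 - 2 * m ≤ l := by exact_mod_cast hb.2
  -- The minus sign in the exponent reverses the numbering. The closed bound suffices: l-1-2m = ±l
  -- would give 2m = -1 or 2m = 2l-1, impossible by parity.
  refine ⟨((l : ℤ) - 1 - m).toNat, Finset.mem_range.mpr (by omega), ?_⟩
  have hj : ((((l : ℤ) - 1 - m).toNat : ℕ) : ℂ) = (l : ℂ) - 1 - m := by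
    have : ((((l : ℤ) - 1 - m).toNat : ℕ) : ℤ) = (l : ℤ) - 1 - m := Int.toNat_of_nonneg (by omega)
    exact_mod_cast congrArg (Int.cast : ℤ → ℂ) this
  rw [zeroLeft, hj]
  field_simp
  linear_combination hm

theorem exists_zeroRight {ρ : ℝ} (hρ : ρ < 1) {k : ℕ} {z : ℂ}
    (h : signedOneAddExp k z = 0) (hz : |z.im| ≤ Real.pi * (ρ + k)) :
    ∃ j ∈ Finset.range k, zeroRight k j = z := by
  obtain ⟨m, hm⟩ := (signedOneAddExp_eq_zero_iff _ _).mp h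
  have him : z.im = ((k : ℝ) - 1 - 2 * m) * Real.pi := by
    have := congrArg Complex.im hm
    simpa using this
  -- Here ρ < 1 excludes the next zeros m = -1 and m = k, at height ±π(k+1).
  have hb : |(k : ℝ) - 1 - 2 * m| < k + 1 := by
    rw [him, abs_mul, abs_of_pos Real.pi_pos, mul_comm] at hz
    linarith [le_of_mul_le_mul_left hz Real.pi_pos]
  rw [abs_lt] at hb
  have hb1 : -((k : ℤ) + 1) < k - 1 - 2 * m := by exact_mod_cast hb.1
  have hb2 : (k : ℤ) - 1 - 2 * m < k + 1 := by exact_mod_cast hb.2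
  refine ⟨m.toNat, Finset.mem_range.mpr (by omega), ?_⟩
  have hj : ((m.toNat : ℕ) : ℂ) = m := by
    have : ((m.toNat : ℕ) : ℤ) = m := Int.toNat_of_nonneg (by omega)
    exact_mod_cast congrArg (Int.cast : ℤ → ℂ) this
  rw [zeroRight, hj, hm]

theorem abs_sub_one_sub_two_mul_le {n j : ℕ} (hj : j < n) : |(n : ℝ) - 1 - 2 * j| ≤ n - 1 := by
  have : (j : ℝ) + 1 ≤ n := by exact_mod_cast hj
  rw [abs_le]; constructor <;> linarith [(Nat.cast_nonneg j : (0 : ℝ) ≤ j)]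

/-- Since L > 0, the two families of zeros lie on the distinct lines re z = L and re z = 0, so every
zero of the product is simple. -/
theorem rectIntegral_inv_contourDenom {α ρ L R : ℝ} {k l : ℕ} (hα : 0 < α) (hρ0 : 0 < ρ)
    (hρ : ρ < 1) (h : ρ + k = l / α) (hL : 0 < L) (hR : L < R) :
    rectIntegral (fun z => (contourDenom α L k l z)⁻¹) (-R) R
      (-(Real.pi * (ρ + k))) (Real.pi * (ρ + k)) =
    2 * Real.pi * I *
      (∑ j ∈ Finset.range l, (α * signedOneAddExp k (zeroLeft α L l j))⁻¹ -
        ∑ j ∈ Finset.range k, (signedOneAddExp l (-(α * (zeroRight k j - L))))⁻¹) := by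
  classical
  have hpi := Real.pi_pos
  have hα' : (α : ℂ) ≠ 0 := by exact_mod_cast hα.ne'
  have hk0 : (0 : ℝ) ≤ k := Nat.cast_nonneg k
  have hY : 0 < Real.pi * (ρ + k) := by positivity
  have hB : ∀ j, signedOneAddExp k (zeroLeft α L l j) ≠ 0 := fun j =>
    signedOneAddExp_ne_zero (by rw [zeroLeft_re]; exact hL.ne')
  have hA : ∀ j, signedOneAddExp l (-(α * (zeroRight k j - L))) ≠ 0 := fun j =>
    signedOneAddExp_ne_zero (by simp [zeroRight_re, hα.ne', hL.ne'])
  set S₁ := (Finset.range l).image (zeroLeft α L l) with hS₁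
  set S₂ := (Finset.range k).image (zeroRight k) with hS₂
  have hdisj : Disjoint S₁ S₂ := by
    rw [Finset.disjoint_left]
    intro z h1 h2
    obtain ⟨i, -, rfl⟩ := Finset.mem_image.mp h1
    obtain ⟨j, -, hj⟩ := Finset.mem_image.mp h2
    have := congrArg Complex.re hj
    rw [zeroRight_re, zeroLeft_re] at this
    exact hL.ne this
  -- At a zero of one factor its exponential term equals -1, so the derivative of the product
  -- reduces to α times the second factor here, and to minus the first factor in `hd2`.
  have hd1 : ∀ j, (-1) ^ l * exp (-(α * (zeroLeft α L l j - L))) * -α *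
      signedOneAddExp k (zeroLeft α L l j) +
      signedOneAddExp l (-(α * (zeroLeft α L l j - L))) * ((-1) ^ k * exp (zeroLeft α L l j)) =
      α * signedOneAddExp k (zeroLeft α L l j) := by
    intro j
    have h0 := signedOneAddExp_zeroLeft hα L l j
    rw [h0]
    rw [signedOneAddExp] at h0
    linear_combination -(α : ℂ) * signedOneAddExp k (zeroLeft α L l j) * h0
  have hd2 : ∀ j, (-1) ^ l * exp (-(α * (zeroRight k j - L))) * -α *
      signedOneAddExp k (zeroRight k j) +
      signedOneAddExp l (-(α * (zeroRight k j - L))) * ((-1) ^ k * exp (zeroRight k j)) =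
      -signedOneAddExp l (-(α * (zeroRight k j - L))) := by
    intro j
    have h0 := signedOneAddExp_zeroRight k j
    rw [h0]
    have h1 : (-1) ^ k * exp (zeroRight k j) = -1 := by
      rw [signedOneAddExp] at h0; linear_combination h0
    rw [h1]; ring
  have hinj1 : InjOn (zeroLeft α L l) (Finset.range l) := by
    intro i _ j _ hij
    have h1 := congrArg Complex.im hij
    rw [zeroLeft_im, zeroLeft_im, div_left_inj' hα.ne'] at h1
    have h2 := mul_right_cancel₀ hpi.ne' h1
    have h3 : (i : ℝ) = j := by linarith
    exact_mod_cast h3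
  have hinj2 : InjOn (zeroRight k) (Finset.range k) := by
    intro i _ j _ hij
    have h1 := congrArg Complex.im hij
    rw [zeroRight_im, zeroRight_im] at h1
    have h2 := mul_right_cancel₀ hpi.ne' h1
    have h3 : (i : ℝ) = j := by linarith
    exact_mod_cast h3
  rw [rectIntegral_inv_eq_sum (S := S₁ ∪ S₂) (by linarith) (by linarith) ?_
    (fun z => (hasDerivAt_contourDenom α L k l z).differentiableAt) ?_ ?_
    (fun z _ => hasDerivAt_contourDenom α L k l z) ?_]
  · rw [Finset.sum_union hdisj, hS₁, hS₂, Finset.sum_image hinj1, Finset.sum_image hinj2]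
    simp only [hd1, hd2, inv_neg, Finset.sum_neg_distrib, ← sub_eq_add_neg]
  · intro z hz
    rcases Finset.mem_union.mp (Finset.mem_coe.mp hz) with h1 | h1
    · obtain ⟨j, hj, rfl⟩ := Finset.mem_image.mp h1
      refine ⟨?_, ?_⟩
      · rw [mem_preimage, zeroLeft_re]; exact ⟨by linarith, hR⟩
      · rw [mem_preimage, zeroLeft_im, mem_Ioo, ← abs_lt, h, abs_div, abs_mul, abs_of_pos hpi,
          abs_of_pos hα, mul_div_assoc', mul_comm Real.pi]
        have := abs_sub_one_sub_two_mul_le (Finset.mem_range.mp hj)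
        gcongr
        linarith
    · obtain ⟨j, hj, rfl⟩ := Finset.mem_image.mp h1
      refine ⟨?_, ?_⟩
      · rw [mem_preimage, zeroRight_re]; exact ⟨by linarith, by linarith⟩
      · rw [mem_preimage, zeroRight_im, mem_Ioo, ← abs_lt, abs_mul, abs_of_pos hpi,
          mul_comm Real.pi]
        have := abs_sub_one_sub_two_mul_le (Finset.mem_range.mp hj)
        gcongr
        linarith
  · intro z hz h0
    have him : |z.im| ≤ Real.pi * (ρ + k) := abs_le.mpr hz.2
    rcases mul_eq_zero.mp h0 with h1 | h1
    · obtain ⟨j, hj, rfl⟩ := exists_zeroLeft hα h1 (h ▸ him)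
      exact Finset.mem_union_left _ (Finset.mem_image_of_mem _ hj)
    · obtain ⟨j, hj, rfl⟩ := exists_zeroRight hρ h1 him
      exact Finset.mem_union_right _ (Finset.mem_image_of_mem _ hj)
  · intro p hp
    rcases Finset.mem_union.mp hp with h1 | h1
    · obtain ⟨j, hj, rfl⟩ := Finset.mem_image.mp h1
      rw [contourDenom, signedOneAddExp_zeroLeft hα, zero_mul]
    · obtain ⟨j, hj, rfl⟩ := Finset.mem_image.mp h1
      rw [contourDenom, signedOneAddExp_zeroRight, mul_zero]
  · intro p hp
    rcases Finset.mem_union.mp hp with h1 | h1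
    · obtain ⟨j, hj, rfl⟩ := Finset.mem_image.mp h1
      rw [hd1]; exact mul_ne_zero hα' (hB j)
    · obtain ⟨j, hj, rfl⟩ := Finset.mem_image.mp h1
      rw [hd2]; exact neg_ne_zero.mpr (hA j)

end Contour

/-! ### Letting the rectangle become an infinite strip. -/

section ContourLimit

open Complex MeasureTheory Set Filter Topology

theorem exp_add_mul_I_sub (x θ : ℝ) :
    exp (x + θ * I) - exp (x - θ * I) = 2 * I * exp x * Real.sin θ := by
  rw [sub_eq_add_neg (x : ℂ), ← neg_mul, exp_add, exp_add, exp_mul_I, exp_mul_I]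
  push_cast
  simp only [cos_neg, sin_neg]
  ring

theorem one_add_exp_mul_one_add_exp (x θ : ℝ) :
    (1 + exp (x + θ * I)) * (1 + exp (x - θ * I)) =
      2 * exp x * ((Real.cosh x + Real.cos θ : ℝ) : ℂ) := by
  have h : exp (x : ℂ) * exp (-x) = 1 := by rw [← exp_add]; simp
  have h2 := Complex.sin_sq_add_cos_sq (θ : ℂ)
  rw [sub_eq_add_neg (x : ℂ), ← neg_mul, exp_add, exp_add, exp_mul_I, exp_mul_I]
  push_cast
  simp only [cos_neg, sin_neg, Complex.cosh]
  linear_combination (exp (x : ℂ)) ^ 2 * h2 - h -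
    exp (x : ℂ) ^ 2 * Complex.sin θ ^ 2 * I_sq

theorem one_add_exp_add_mul_I_ne_zero {θ : ℝ} (hc : -1 < Real.cos θ) (x : ℝ) :
    1 + exp (x + θ * I) ≠ 0 ∧ 1 + exp (x - θ * I) ≠ 0 := by
  rw [← mul_ne_zero_iff, one_add_exp_mul_one_add_exp]
  exact mul_ne_zero (mul_ne_zero two_ne_zero (exp_ne_zero _))
    (ofReal_ne_zero.mpr (cosh_add_pos hc x).ne')

/-- The jump between the conjugate lines im = ∓θ recovers the hyperbolic kernel. -/
theorem inv_one_add_exp_sub_inv {θ : ℝ} (hc : -1 < Real.cos θ) (x : ℝ) :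
    (1 + exp (x - θ * I))⁻¹ - (1 + exp (x + θ * I))⁻¹ =
      I * Real.sin θ * (((Real.cosh x + Real.cos θ)⁻¹ : ℝ) : ℂ) := by
  obtain ⟨h1, h2⟩ := one_add_exp_add_mul_I_ne_zero hc x
  have h3 := one_add_exp_mul_one_add_exp x θ
  have h4 := exp_add_mul_I_sub x θ
  have h5 : ((Real.cosh x + Real.cos θ : ℝ) : ℂ) ≠ 0 := ofReal_ne_zero.mpr (cosh_add_pos hc x).ne'
  rw [inv_sub_inv h2 h1, add_sub_add_left_eq_sub, h4, mul_comm (1 + exp (x - θ * I)), h3,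
    ofReal_inv]
  have := exp_ne_zero (x : ℂ)
  field_simp

/-- At height π(ρ+k) the exponent of the first factor is shifted by -lπi, since α(ρ+k) = l, and that
of the second by kπi + πρi. Both signs cancel, leaving only the angle πρ. -/
theorem contourDenom_top {α ρ : ℝ} {k l : ℕ} (hα : 0 < α) (h : ρ + k = l / α) (L x : ℝ) :
    contourDenom α L k l (x + (Real.pi * (ρ + k) : ℝ) * I) =
      (1 + (Real.exp (-(α * (x - L))) : ℝ)) * (1 + exp (x + (Real.pi * ρ : ℝ) * I)) := by
  have hl : α * (ρ + k) = (l : ℂ) := by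
    have : α * (ρ + k) = l := by rw [h]; field_simp
    exact_mod_cast congrArg (ofReal : ℝ → ℂ) this
  rw [contourDenom, ← signedOneAddExp_add_pi k, ofReal_exp, ← signedOneAddExp_sub_pi l]
  congr 2
  · push_cast; linear_combination -(Real.pi : ℂ) * I * hl
  · push_cast; ring

theorem contourDenom_bottom {α ρ : ℝ} {k l : ℕ} (hα : 0 < α) (h : ρ + k = l / α) (L x : ℝ) :
    contourDenom α L k l (x + (-(Real.pi * (ρ + k)) : ℝ) * I) =
      (1 + (Real.exp (-(α * (x - L))) : ℝ)) * (1 + exp (x - (Real.pi * ρ : ℝ) * I)) := by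
  have hl : α * (ρ + k) = (l : ℂ) := by
    have : α * (ρ + k) = l := by rw [h]; field_simp
    exact_mod_cast congrArg (ofReal : ℝ → ℂ) this
  rw [contourDenom, ← signedOneAddExp_sub_pi k, ofReal_exp, ← signedOneAddExp_add_pi l]
  congr 2
  · push_cast; linear_combination (Real.pi : ℂ) * I * hl
  · push_cast; ring

/-- A bound for `1 / contourDenom` on the vertical line `re z = x`. -/
noncomputable def sideBound (α L x : ℝ) : ℝ :=
  (|Real.exp (-(α * (x - L))) - 1| * |Real.exp x - 1|)⁻¹

theorem norm_inv_contourDenom_le {α L x : ℝ} (hα : 0 < α) (hx : x ≠ 0) (hxL : x ≠ L) (k l : ℕ)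
    (y : ℝ) : ‖(contourDenom α L k l (x + y * I))⁻¹‖ ≤ sideBound α L x := by
  have hpos : ∀ u : ℝ, u ≠ 0 → 0 < |Real.exp u - 1| := fun u hu =>
    abs_pos.mpr (sub_ne_zero.mpr (by rwa [Ne, Real.exp_eq_one_iff]))
  rw [norm_inv, contourDenom, norm_mul, sideBound]
  refine inv_anti₀ (mul_pos (hpos _ ?_) (hpos _ hx)) ?_
  · exact neg_ne_zero.mpr (mul_ne_zero hα.ne' (sub_ne_zero.mpr hxL))
  · refine mul_le_mul ?_ ?_ (abs_nonneg _) (norm_nonneg _)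
    · simpa using norm_signedOneAddExp_ge l (-(α * (x + y * I - L)))
    · simpa using norm_signedOneAddExp_ge k (x + y * I)

theorem tendsto_abs_exp_sub_one_atTop : Tendsto (fun x : ℝ => |Real.exp x - 1|) atTop atTop :=
  tendsto_abs_atTop_atTop.comp (tendsto_atTop_add_const_right _ (-1) Real.tendsto_exp_atTop)

theorem tendsto_abs_exp_sub_one_atBot : Tendsto (fun x : ℝ => |Real.exp x - 1|) atBot (𝓝 1) := by
  simpa using (Real.tendsto_exp_atBot.sub_const 1).abs

/-- One factor tends to 1 while the other blows up; at -∞ their roles are exchanged. -/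
theorem tendsto_sideBound_atTop {α : ℝ} (hα : 0 < α) (L : ℝ) :
    Tendsto (sideBound α L) atTop (𝓝 0) := by
  have h1 : Tendsto (fun x : ℝ => -(α * (x - L))) atTop atBot :=
    tendsto_neg_atTop_atBot.comp
      ((tendsto_atTop_add_const_right _ (-L) tendsto_id).const_mul_atTop hα)
  exact ((tendsto_abs_exp_sub_one_atBot.comp h1).pos_mul_atTop one_pos
    tendsto_abs_exp_sub_one_atTop).inv_tendsto_atTop

theorem tendsto_sideBound_atBot {α : ℝ} (hα : 0 < α) (L : ℝ) :
    Tendsto (sideBound α L) atBot (𝓝 0) := by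
  have h1 : Tendsto (fun x : ℝ => -(α * (x - L))) atBot atTop :=
    tendsto_neg_atBot_atTop.comp
      ((tendsto_atBot_add_const_right _ (-L) tendsto_id).const_mul_atBot hα)
  exact ((tendsto_abs_exp_sub_one_atTop.comp h1).atTop_mul_pos one_pos
    tendsto_abs_exp_sub_one_atBot).inv_tendsto_atTop

theorem tendsto_side_integral {α L : ℝ} (hα : 0 < α) (k l : ℕ) (Y : ℝ) {F : Filter ℝ}
    (hF : Tendsto (sideBound α L) F (𝓝 0)) (h0 : ∀ᶠ x in F, x ≠ 0 ∧ x ≠ L) :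
    Tendsto (fun x : ℝ => ∫ y : ℝ in -Y..Y, (contourDenom α L k l (x + y * I))⁻¹) F (𝓝 0) := by
  have h1 := hF.mul_const |Y - -Y|
  rw [zero_mul] at h1
  refine squeeze_zero_norm' (h0.mono fun x hx => ?_) h1
  exact intervalIntegral.norm_integral_le_of_norm_le_const fun y _ =>
    norm_inv_contourDenom_le hα hx.1 hx.2 k l y

theorem integral_horizontal_sub {α ρ : ℝ} {k l : ℕ} (hα : 0 < α) (h : ρ + k = l / α)
    (hc : -1 < Real.cos (Real.pi * ρ)) (L a b : ℝ) :
    (∫ x : ℝ in a..b, (contourDenom α L k l (x + (-(Real.pi * (ρ + k)) : ℝ) * I))⁻¹) -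
      (∫ x : ℝ in a..b, (contourDenom α L k l (x + (Real.pi * (ρ + k) : ℝ) * I))⁻¹) =
    I * Real.sin (Real.pi * ρ) * ((∫ x : ℝ in a..b,
      (1 + Real.exp (-(α * (x - L))))⁻¹ * (Real.cosh x + Real.cos (Real.pi * ρ))⁻¹ : ℝ) : ℂ) := by
  have hne : ∀ x : ℝ, (1 + (Real.exp (-(α * (x - L))) : ℝ) : ℂ) ≠ 0 := fun x => by
    have : (0 : ℝ) < 1 + Real.exp (-(α * (x - L))) := by positivity
    exact_mod_cast this.ne'
  simp only [contourDenom_top hα h, contourDenom_bottom hα h]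
  rw [← intervalIntegral.integral_sub, ← intervalIntegral.integral_ofReal,
    ← intervalIntegral.integral_const_mul]
  · refine intervalIntegral.integral_congr fun x _ => ?_
    simp only [mul_inv]
    rw [← mul_sub, inv_one_add_exp_sub_inv hc]
    push_cast; ring
  · refine (Continuous.inv₀ (by fun_prop) fun x => ?_).intervalIntegrable _ _
    exact mul_ne_zero (hne x) (one_add_exp_add_mul_I_ne_zero hc x).2
  · refine (Continuous.inv₀ (by fun_prop) fun x => ?_).intervalIntegrable _ _
    exact mul_ne_zero (hne x) (one_add_exp_add_mul_I_ne_zero hc x).1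

theorem neg_one_lt_cos_pi_mul {ρ : ℝ} (h0 : 0 < ρ) (h1 : ρ < 1) : -1 < Real.cos (Real.pi * ρ) := by
  rw [← Real.cos_pi]
  exact Real.cos_lt_cos_of_nonneg_of_le_pi (by positivity) le_rfl
    (mul_lt_of_lt_one_right Real.pi_pos h1)

theorem sin_mul_integral_logistic {α ρ L : ℝ} {k l : ℕ} (hα : 0 < α) (hρ0 : 0 < ρ)
    (hρ : ρ < 1) (h : ρ + k = l / α) (hL : 0 < L) :
    Real.sin (Real.pi * ρ) * ((∫ x : ℝ, (1 + Real.exp (-(α * (x - L))))⁻¹ *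
      (Real.cosh x + Real.cos (Real.pi * ρ))⁻¹ : ℝ) : ℂ) =
    2 * Real.pi *
      (∑ j ∈ Finset.range l, (α * signedOneAddExp k (zeroLeft α L l j))⁻¹ -
        ∑ j ∈ Finset.range k, (signedOneAddExp l (-(α * (zeroRight k j - L))))⁻¹) := by
  have hc := neg_one_lt_cos_pi_mul hρ0 hρ
  have hint := integrable_logistic_mul_inv_cosh_add hc (Real.cos_le_one _) α L
  have h1 := (continuous_ofReal.tendsto _).comp
    (intervalIntegral_tendsto_integral hint tendsto_neg_atTop_atBot tendsto_id)
  have h2 := h1.const_mul (I * Real.sin (Real.pi * ρ))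
  have hs1 := tendsto_side_integral hα k l (Real.pi * (ρ + k)) (tendsto_sideBound_atTop hα L)
    ((eventually_gt_atTop L).mono fun x hx => ⟨(hL.trans hx).ne', hx.ne'⟩)
  have hs2 := (tendsto_side_integral hα k l (Real.pi * (ρ + k)) (tendsto_sideBound_atBot hα L)
    ((eventually_lt_atBot 0).mono fun x hx => ⟨hx.ne, (hx.trans hL).ne⟩)).comp
    tendsto_neg_atTop_atBot
  have h3 := (h2.add (hs1.const_mul I)).sub (hs2.const_mul I)
  rw [mul_zero, add_zero, sub_zero] at h3
  -- For R > L the residue sum no longer depends on R, so the limit of the boundary integral is that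
  -- constant.
  have h4 := tendsto_nhds_unique h3 ((tendsto_const_nhds (x := 2 * Real.pi * I *
      (∑ j ∈ Finset.range l, (α * signedOneAddExp k (zeroLeft α L l j))⁻¹ -
        ∑ j ∈ Finset.range k, (signedOneAddExp l (-(α * (zeroRight k j - L))))⁻¹))).congr' ?_)
  · refine mul_left_cancel₀ I_ne_zero ?_
    linear_combination h4
  · filter_upwards [eventually_gt_atTop L] with R hR
    rw [← rectIntegral_inv_contourDenom hα hρ0 hρ h hL hR, rectIntegral,
      integral_horizontal_sub hα h hc]
    rfl

/-- With this x one has (-1)^n e^s = -1/x, so the factor is (x - e^{iψ})/x and its reciprocal has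
denominator |x - e^{iψ}|². This is the source of the exponents k+1 and l+1 in the theorem. -/
theorem re_inv_signedOneAddExp (n : ℕ) (s ψ : ℝ) {x : ℝ} (hx : x = (-1) ^ (n + 1) * Real.exp (-s)) :
    ((signedOneAddExp n (s + ψ * I))⁻¹).re =
      x * (x - Real.cos ψ) / (x ^ 2 - 2 * x * Real.cos ψ + 1) := by
  have hx0 : (x : ℂ) ≠ 0 := by
    rw [ofReal_ne_zero, hx]; exact mul_ne_zero (pow_ne_zero _ (by norm_num)) (Real.exp_pos _).ne'
  have h1 : (x : ℂ) * ((-1) ^ n * exp s) = -1 := by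
    have h2 : (-1 : ℂ) ^ n * (-1) ^ n = 1 := by rw [← mul_pow]; simp
    have h3 : exp (-(s : ℂ)) * exp s = 1 := by rw [← exp_add]; simp
    rw [hx, pow_succ]; push_cast
    linear_combination -(exp (-(s : ℂ)) * exp s) * h2 - h3
  have h4 : signedOneAddExp n (s + ψ * I) = (x - exp (ψ * I)) / x := by
    rw [signedOneAddExp, exp_add, eq_div_iff hx0]
    linear_combination exp (ψ * I) * h1
  rw [h4, inv_div, div_eq_mul_inv, re_ofReal_mul, inv_re, normSq_sub_exp_mul_I, sub_re, ofReal_re,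
    exp_ofReal_mul_I_re, mul_div_assoc]

theorem sin_mul_integral_logistic_eq_sum {α ρ L : ℝ} {k l : ℕ} (hα : 0 < α) (hρ0 : 0 < ρ)
    (hρ : ρ < 1) (h : ρ + k = l / α) (hL : 0 < L) {x y : ℝ}
    (hx : x = (-1) ^ (k + 1) * Real.exp (-L)) (hy : y = (-1) ^ (l + 1) * Real.exp (-(α * L))) :
    α * Real.sin (Real.pi * ρ) * (∫ x : ℝ, (1 + Real.exp (-(α * (x - L))))⁻¹ *
      (Real.cosh x + Real.cos (Real.pi * ρ))⁻¹) =
    2 * Real.pi *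
      (∑ j ∈ Finset.range l, x * (x - Real.cos (((l : ℝ) - 1 - 2 * j) * (1 / α) * Real.pi)) /
          (x ^ 2 - 2 * x * Real.cos (((l : ℝ) - 1 - 2 * j) * (1 / α) * Real.pi) + 1) -
        α * ∑ j ∈ Finset.range k, y * (y - Real.cos (((k : ℝ) - 1 - 2 * j) * α * Real.pi)) /
          (y ^ 2 - 2 * y * Real.cos (((k : ℝ) - 1 - 2 * j) * α * Real.pi) + 1)) := by
  have hA : ∀ j, ((signedOneAddExp k (zeroLeft α L l j))⁻¹).re =
      x * (x - Real.cos (((l : ℝ) - 1 - 2 * j) * (1 / α) * Real.pi)) /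
          (x ^ 2 - 2 * x * Real.cos (((l : ℝ) - 1 - 2 * j) * (1 / α) * Real.pi) + 1) := by
    intro j
    rw [← re_inv_signedOneAddExp k L _ hx, zeroLeft]
    congr 3; push_cast; ring
  have hB : ∀ j, ((signedOneAddExp l (-(α * (zeroRight k j - L))))⁻¹).re =
      y * (y - Real.cos (((k : ℝ) - 1 - 2 * j) * α * Real.pi)) /
          (y ^ 2 - 2 * y * Real.cos (((k : ℝ) - 1 - 2 * j) * α * Real.pi) + 1) := by
    intro j
    -- The exponent -α(z - L) turns the angle into its negative, which the cosine does not see.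
    rw [← Real.cos_neg, ← re_inv_signedOneAddExp l (α * L) _ hy, zeroRight]
    congr 3; push_cast; ring
  have h1 := congrArg Complex.re (sin_mul_integral_logistic hα hρ0 hρ h hL)
  rw [← ofReal_ofNat, ← ofReal_mul, ← ofReal_mul, re_ofReal_mul, ofReal_re, sub_re, re_sum,
    re_sum] at h1
  simp only [mul_inv, ← ofReal_inv, re_ofReal_mul, hA, hB, ← Finset.mul_sum] at h1
  rw [mul_assoc, h1, mul_left_comm, mul_sub, mul_inv_cancel_left₀ hα.ne']

end ContourLimit

/-! ### Matching derivatives and limits at infinity. -/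

section Conclusion

open Real MeasureTheory Set Filter Topology

/-- The ½ in `symmLogSum` cancels the 2 from differentiating the quadratic, and dx/dL = -bx supplies
the factor x found in the residues. The rate b covers both arguments: b = 1 for β and b = α for β^α.
-/
theorem hasDerivAt_symmLogSum_exp (n : ℕ) (a b : ℝ) {σ L x : ℝ} (hx : x = σ * exp (-(b * L)))
    (hx1 : |x| < 1) :
    HasDerivAt (fun L => symmLogSum n a (σ * exp (-(b * L))))
      (-b * ∑ j ∈ Finset.range n, x * (x - cos (((n : ℝ) - 1 - 2 * j) * a * π)) /
          (x ^ 2 - 2 * x * cos (((n : ℝ) - 1 - 2 * j) * a * π) + 1)) L := by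
  have h1 : HasDerivAt (fun L => σ * exp (-(b * L))) (-b * x) L := by
    have h2 : HasDerivAt (fun L : ℝ => -(b * L)) (-b) L := by
      simpa using ((hasDerivAt_id L).const_mul b).fun_neg
    refine (h2.exp.const_mul σ).congr_deriv ?_
    rw [hx]; ring
  have h3 : HasDerivAt (symmLogSum n a) (∑ j ∈ Finset.range n,
      (x - cos (((n : ℝ) - 1 - 2 * j) * a * π)) /
          (x ^ 2 - 2 * x * cos (((n : ℝ) - 1 - 2 * j) * a * π) + 1)) x := by
    have h4 : ∀ j ∈ Finset.range n, HasDerivAt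
        (fun x => log (x ^ 2 - 2 * x * cos (((n : ℝ) - 1 - 2 * j) * a * π) + 1))
        (2 * ((x - cos (((n : ℝ) - 1 - 2 * j) * a * π)) /
          (x ^ 2 - 2 * x * cos (((n : ℝ) - 1 - 2 * j) * a * π) + 1))) x := by
      intro j _
      have h5 : HasDerivAt (fun x => x ^ 2 - 2 * x * cos (((n : ℝ) - 1 - 2 * j) * a * π) + 1)
          (2 * x - 2 * cos (((n : ℝ) - 1 - 2 * j) * a * π)) x := by
        simpa using (((hasDerivAt_pow 2 x).sub
          (((hasDerivAt_id x).const_mul 2).mul_const _)).add_const 1)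
      refine (h5.log (sq_sub_two_mul_cos_add_one_pos hx1 _).ne').congr_deriv ?_
      rw [mul_div_assoc', mul_sub]
    refine ((HasDerivAt.fun_sum h4).div_const 2).congr_deriv ?_
    rw [← Finset.mul_sum]; ring
  rw [hx] at h3
  refine (h3.comp L h1).congr_deriv ?_
  rw [← hx, mul_comm, mul_assoc, Finset.mul_sum]
  simp only [mul_div_assoc]

theorem tendsto_symmLogSum_exp (n : ℕ) (a σ : ℝ) {b : ℝ} (hb : 0 < b) :
    Tendsto (fun L => symmLogSum n a (σ * exp (-(b * L)))) atTop (𝓝 0) := by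
  have h1 : ContinuousAt (symmLogSum n a) 0 := by
    refine ContinuousAt.div_const (tendsto_finsetSum _ fun j _ => ?_) 2
    exact ContinuousAt.log (by fun_prop) (by simp)
  have h2 : Tendsto (fun L => σ * exp (-(b * L))) atTop (𝓝 0) := by
    simpa using (tendsto_exp_neg_atTop_nhds_zero.comp
      (tendsto_id.const_mul_atTop hb)).const_mul σ
  have h3 := h1.tendsto.comp h2
  simpa [symmLogSum, Function.comp_def] using h3

theorem abs_neg_one_pow_mul_exp_lt_one (n : ℕ) {u : ℝ} (hu : 0 < u) :
    |(-1) ^ n * exp (-u)| < 1 := by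
  rw [abs_mul, abs_pow, abs_neg, abs_one, one_pow, one_mul, abs_of_pos (exp_pos _)]
  exact exp_lt_one_iff.mpr (neg_lt_zero.mpr hu)

/-- The difference of the two sides, as a function of L, has zero derivative on (0, ∞) and tends to
0 at infinity. -/
theorem sin_mul_integral_log_eq_symmLogSum {α ρ L : ℝ} {k l : ℕ} (hα : 0 < α) (hα2 : α ≤ 2)
    (hρ0 : 0 < ρ) (hρ : ρ < 1) (h : ρ + k = l / α) (hL : 0 < L) :
    sin (π * ρ) / (2 * π) *
      (∫ t : ℝ, log (1 + exp (α * (t - L))) * (cosh t + cos (π * ρ))⁻¹) =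
    symmLogSum l (1 / α) ((-1) ^ (k + 1) * exp (-(1 * L))) -
      symmLogSum k α ((-1) ^ (l + 1) * exp (-(α * L))) := by
  have hc := neg_one_lt_cos_pi_mul hρ0 hρ
  set D : ℝ → ℝ := fun L => sin (π * ρ) / (2 * π) *
      (∫ t : ℝ, log (1 + exp (α * (t - L))) * (cosh t + cos (π * ρ))⁻¹) -
    (symmLogSum l (1 / α) ((-1) ^ (k + 1) * exp (-(1 * L))) -
      symmLogSum k α ((-1) ^ (l + 1) * exp (-(α * L)))) with hD
  have hderiv : ∀ L ∈ Ioi (0 : ℝ), HasDerivAt D 0 L := by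
    intro L hL
    rw [mem_Ioi] at hL
    have h1 := (hasDerivAt_integral_log_div_cosh_add hc (cos_le_one _) hα hα2 hL).const_mul
      (sin (π * ρ) / (2 * π))
    have h2 := hasDerivAt_symmLogSum_exp l (1 / α) 1 (σ := (-1) ^ (k + 1)) (L := L) rfl
      (abs_neg_one_pow_mul_exp_lt_one (k + 1) (by positivity))
    have h3 := hasDerivAt_symmLogSum_exp k α α (σ := (-1) ^ (l + 1)) (L := L) rfl
      (abs_neg_one_pow_mul_exp_lt_one (l + 1) (by positivity))
    refine (h1.sub (h2.sub h3)).congr_deriv ?_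
    have h4 := sin_mul_integral_logistic_eq_sum hα hρ0 hρ h hL
      (x := (-1) ^ (k + 1) * exp (-(1 * L))) (by rw [one_mul]) rfl
    set J := ∫ x : ℝ, (1 + exp (-(α * (x - L))))⁻¹ * (cosh x + cos (π * ρ))⁻¹
    have h5 : sin (π * ρ) / (2 * π) * (-α * J) = -(α * sin (π * ρ) * J) / (2 * π) := by ring
    rw [h5, h4]
    have := pi_pos
    field_simp
    ring
  have hlim : Tendsto D atTop (𝓝 0) := by
    have h1 := (tendsto_integral_log_div_cosh_add hc (cos_le_one _) hα hα2).const_mul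
      (sin (π * ρ) / (2 * π))
    have h2 := h1.sub ((tendsto_symmLogSum_exp l (1 / α) ((-1) ^ (k + 1)) one_pos).sub
      (tendsto_symmLogSum_exp k α ((-1) ^ (l + 1)) hα))
    simpa [hD] using h2
  have hconst : ∀ M ∈ Ioi (0 : ℝ), D M = D L := fun M hM =>
    isOpen_Ioi.is_const_of_deriv_eq_zero isPreconnected_Ioi
      (fun x hx => (hderiv x hx).differentiableAt.differentiableWithinAt)
      (fun x hx => (hderiv x hx).deriv) hM hL
  have h0 : D L = 0 := tendsto_nhds_unique
    (tendsto_const_nhds.congr' ((eventually_gt_atTop 0).mono fun M hM => (hconst M hM).symm)) hlim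
  exact sub_eq_zero.mp h0

end Conclusion

theorem mainTheorem3 :
    (∀ (α ρ β : ℝ) (k l : ℕ), 0 < α → α ≤ 2 →
      0 < ρ → ρ < 1 →
      ρ + (k : ℝ) = (l : ℝ) / α → 0 < β → β < 1 →
        MeasureTheory.IntegrableOn (stableGIntegrand α ρ β) (Set.Ioi 0) ∧
        stableG α ρ β =
          chebyshevSeries k α ((-1) ^ (l + 1) * β ^ α) -
            chebyshevSeries l (1 / α) ((-1) ^ (k + 1) * β) ∧
        stableG α ρ β =
          logQuadraticSum l (1 / α) ((-1) ^ (k + 1) * β) -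
            logQuadraticSum k α ((-1) ^ (l + 1) * β ^ α)) ∧
    (∀ (k : ℕ) (a x : ℝ), |x| < 1 →
      Summable (fun m : ℕ => chebyshevTerm k a x (m + 1)) ∧
      chebyshevSeries k a x = -logQuadraticSum k a x) := by
  have hseries : ∀ (k : ℕ) (a x : ℝ), |x| < 1 →
      Summable (fun m : ℕ => chebyshevTerm k a x (m + 1)) ∧
      chebyshevSeries k a x = -logQuadraticSum k a x := fun k a x hx => by
    have h := hasSum_chebyshevTerm k a hx
    exact ⟨h.summable, by rw [chebyshevSeries, h.tsum_eq, logQuadraticSum_eq_symmLogSum]⟩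
  refine ⟨fun α ρ β k l hα hα2 hρ0 hρ h hβ0 hβ1 => ?_, hseries⟩
  -- The condition β < 1 is exactly L > 0, which keeps the two lines of poles apart.
  obtain ⟨L, hL, rfl⟩ : ∃ L : ℝ, 0 < L ∧ β = Real.exp (-L) :=
    ⟨-Real.log β, neg_pos.mpr (Real.log_neg hβ0 hβ1), by rw [neg_neg, Real.exp_log hβ0]⟩
  have hpow : Real.exp (-L) ^ α = Real.exp (-(α * L)) := by
    rw [← Real.exp_mul]; congr 1; ring
  obtain ⟨hint, hG⟩ := integrableOn_stableGIntegrand_and_stableG_eq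
    (neg_one_lt_cos_pi_mul hρ0 hρ) hα hα2 hL.le
  rw [sin_mul_integral_log_eq_symmLogSum hα hα2 hρ0 hρ h hL, one_mul,
    ← logQuadraticSum_eq_symmLogSum, ← logQuadraticSum_eq_symmLogSum, ← hpow] at hG
  refine ⟨hint, ?_, hG⟩
  rw [hG, (hseries k α _ ?_).2, (hseries l (1 / α) _ ?_).2]
  · ring
  · exact abs_neg_one_pow_mul_exp_lt_one _ hL
  · rw [hpow]; exact abs_neg_one_pow_mul_exp_lt_one _ (by positivity)
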